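/- **Lemma (Distance-to-FAF bound).** Let $n\ge 1$ and let $\gamma_1,\dots,\gamma_{2n}$ be the Majorana operators of $n$ fermionic modes, realised on $(\mathbb C^2)^{\otimes n}$ by the Jordan–Wigner formulas $\gamma_{2j-1}=\big(\prod_{k<j}Z_k\big)X_j$, $\gamma_{2j}=\big(\prod_{k<j}Z_k\big)Y_j$. For a density operator $\rho$ let $\Gamma_\rho$ be the real antisymmetric $2n\times 2n$ covariance matrix $(\Gamma_\rho)_{ab}=-\tfrac{i}{2}\operatorname{tr}(\rho[\gamma_a,\gamma_b])$, and let $\operatorname{FAF}_1(\rho)=n-\tfrac12\operatorname{tr}(-\Gamma_\rho^2)$ be the first-order fermionic antiflatness. A fermionic Gaussian state is a state of the form $$\rho_G=\frac{\exp\big[-\tfrac i2\sum_{a<b}K_{ab}\gamma_a\gamma_b\big]}{\operatorname{tr}\exp\big[-\tfrac i2\sum_{a<b}K_{ab}\gamma_a\gamma_b\big]},\qquad K=-K^T\in\mathbb R^{2n\times 2n},$$ or a limit of such states; let $\mathcal G_n$ be the set of pure fermionic Gaussian states. For a pure state $\psi=|\psi\rangle\langle\psi|$ with $\|\psi\|=1$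 let $$\epsilon_G(\psi)=\min_{\phi_G\in\mathcal G_n}\tfrac12\big\|\,|\psi\rangle\langle\psi|-|\phi_G\rangle\langle\phi_G|\,\big\|_1$$ be the trace distance from $\psi$ to the closest pure fermionic Gaussian state. Then, for every pure $n$-mode state $\psi$, this minimum is attained and $$\frac{1}{4n}\operatorname{FAF}_1(\psi)\;\le\;\epsilon_G^2(\psi)\;\le\;\frac12\operatorname{FAF}_1(\psi).$$ -/

import Mathlib

open scoped Matrix

noncomputable section

namespace Fermion

/-- Labels of the computational basis of `n` qubits. -/
abbrev Bits (n : ℕ) : Type := Fin n → Fin 2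

/-- Operators on the Hilbert space of `n` qubits (equivalently, `n` fermionic modes). -/
abbrev Op (n : ℕ) : Type := Matrix (Bits n) (Bits n) ℂ

/-- State vectors of `n` qubits, with the Euclidean norm. -/
abbrev Ket (n : ℕ) : Type := EuclideanSpace ℂ (Bits n)

/-- The Pauli matrix `X`. -/
def pauliX : Matrix (Fin 2) (Fin 2) ℂ := !![0, 1; 1, 0]

/-- The Pauli matrix `Y`. -/
def pauliY : Matrix (Fin 2) (Fin 2) ℂ := !![0, -Complex.I; Complex.I, 0]

/-- The Pauli matrix `Z`. -/
def pauliZ : Matrix (Fin 2) (Fin 2) ℂ := !![1, 0; 0, -1]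

/-- The tensor (Kronecker) product of `n` single-qubit operators, the `k`-th one acting on
qubit `k`. -/
def tensor {n : ℕ} (P : Fin n → Matrix (Fin 2) (Fin 2) ℂ) : Op n :=
  Matrix.of fun x y => ∏ k, P k (x k) (y k)

/-- The `2n` Majorana operators in the Jordan-Wigner representation. Qubits and Majorana labels
are counted from `0`: for a qubit `j`, the operator with label `2j` is `(∏_{k<j} Z_k) X_j` and the
one with label `2j+1` is `(∏_{k<j} Z_k) Y_j`. -/
def majorana {n : ℕ} (a : Fin (2 * n)) : Op n :=
  tensor fun k =>
    if (k : ℕ) < (a : ℕ) / 2 then pauliZ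
    else if (k : ℕ) = (a : ℕ) / 2 then (if (a : ℕ) % 2 = 0 then pauliX else pauliY)
    else 1

/-- The unnormalised Gaussian operator `exp[-(i/2) ∑_{a<b} K_{ab} γ_a γ_b]`. -/
def gaussianExp {n : ℕ} (K : Matrix (Fin (2 * n)) (Fin (2 * n)) ℝ) : Op n :=
  NormedSpace.exp (-(Complex.I / 2) •
    ∑ a, ∑ b, if a < b then (K a b : ℂ) • (majorana a * majorana b) else 0)

/-- The Gaussian density operator with (antisymmetric) parameter matrix `K`. -/
def gaussianState {n : ℕ} (K : Matrix (Fin (2 * n)) (Fin (2 * n)) ℝ) : Op n :=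
  (gaussianExp K).trace⁻¹ • gaussianExp K

/-- A fermionic Gaussian state: a density operator `gaussianState K` with `K` real and
antisymmetric, or a limit of such operators. (For finite `K` these operators are invertible, so
that for `n ≥ 1` the pure Gaussian states occur only as limits.) -/
def IsGaussian {n : ℕ} (ρ : Op n) : Prop :=
  ρ ∈ closure {σ : Op n | ∃ K : Matrix (Fin (2 * n)) (Fin (2 * n)) ℝ,
    Kᵀ = -K ∧ σ = gaussianState K}

/-- The rank-one operator `|ψ⟩⟨ψ|`. -/
def ketbra {n : ℕ} (ψ : Ket n) : Op n :=
  Matrix.of fun x y => ψ x * star (ψ y)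

/-- The set of (unit vectors representing) pure fermionic Gaussian states. -/
def pureGaussian (n : ℕ) : Set (Ket n) :=
  {φ | ‖φ‖ = 1 ∧ IsGaussian (ketbra φ)}

/-- The covariance matrix `Γ_{ab} = -(i/2) tr(ρ [γ_a, γ_b])`; this number is real for every
Hermitian `ρ`. -/
def covariance {n : ℕ} (ρ : Op n) : Matrix (Fin (2 * n)) (Fin (2 * n)) ℝ :=
  Matrix.of fun a b =>
    (-(Complex.I / 2) * (ρ * (majorana a * majorana b - majorana b * majorana a)).trace).re

/-- Fermionic antiflatness of order `k`: `FAF_k(ρ) = n - (1/2) tr[(-Γ²)^k]`. -/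
def FAF {n : ℕ} (k : ℕ) (ρ : Op n) : ℝ :=
  n - (1 / 2) * ((-(covariance ρ ^ 2)) ^ k).trace

/-- The trace norm `‖A‖₁`, the sum of the singular values of `A`, i.e. of the square roots of the
eigenvalues of `Aᴴ A` (with multiplicity). -/
def traceNorm {n : ℕ} (A : Op n) : ℝ :=
  ∑ i, Real.sqrt ((Matrix.isHermitian_conjTranspose_mul_self A).eigenvalues i)

/-- The trace distance `(1/2) ‖ρ - σ‖₁`. -/
def traceDist {n : ℕ} (ρ σ : Op n) : ℝ := (1 / 2) * traceNorm (ρ - σ)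

/-- The trace distances from the pure state `ψ` to the pure fermionic Gaussian states. -/
def gaussianDistances {n : ℕ} (ψ : Ket n) : Set ℝ :=
  {d | ∃ φ ∈ pureGaussian n, d = traceDist (ketbra ψ) (ketbra φ)}

/-- The trace distance `ε_G(ψ)` from `ψ` to the closest pure fermionic Gaussian state. -/
def epsG {n : ℕ} (ψ : Ket n) : ℝ := sInf (gaussianDistances ψ)

end Fermion

end

open scoped ComplexOrder

namespace Fermion

/-! ### Jordan–Wigner operators: anticommutation relations and parity -/

variable {n : ℕ}

/-! For unit vectors the squared trace distance is `1 - F`, with `F` the overlap, so both bounds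
compare `1 - F` with the covariance matrix `Γ` of `ψ`. By antisymmetry, `FAF 1` is `n` minus half
the squared Frobenius norm of `Γ`.

Lower bound. A Gaussian `ρ` is even, and `ρ ⊗ ρ` commutes with `∑ γ_c ⊗ γ_c`. For a pure Gaussian
`φ` these two facts force every row of its covariance matrix to have norm one
(`sum_covariance_sq_of_mem_pureGaussian`). If `v` is row `a`, the involution `-i γ_a v(γ)` has
expectation one in `φ`, hence fixes `φ`, and the projector `(1 + T)/2` built from it dominates
`|φ⟩⟨φ|`. Taking expectations in `ψ` bounds `2F - 1` by the inner product of the `a`-th rows of the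
two covariance matrices; Cauchy–Schwarz and summation over the `2n` rows finish
(`FAF_le_of_mem_pureGaussian`).

Upper bound. The normal form of `Γ` gives orthonormal pairs `e_k, f_k` and numbers `l_k` in `[0,
1]`, with `∑ l_k² = n - FAF 1`. The involutions `S_k = -i e_k(γ) f_k(γ)` commute and have
expectation `l_k` in `ψ`. The product of the `(1 + S_k)/2` is a projector of trace one, hence a pure
state, and it is Gaussian as the limit `t → 1` of the products of `(1 + t S_k)/2`. A union bound
gives `1 - F ≤ ∑ (1 - l_k)/2 ≤ ∑ (1 - l_k²)/2` (`exists_pureGaussian_overlap`).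

The minimum exists because the pure Gaussian vectors form a nonempty compact set. -/

theorem tensor_mul (P Q : Fin n → Matrix (Fin 2) (Fin 2) ℂ) :
    tensor P * tensor Q = tensor fun k => P k * Q k := by
  ext x y
  simp only [tensor, Matrix.mul_apply, Matrix.of_apply, ← Finset.prod_mul_distrib]
  exact (Fintype.prod_sum fun k j => P k (x k) j * Q k j (y k)).symm

theorem tensor_conjTranspose (P : Fin n → Matrix (Fin 2) (Fin 2) ℂ) :
    (tensor P)ᴴ = tensor fun k => (P k)ᴴ := by
  ext x y
  simp [tensor, Matrix.conjTranspose_apply]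

theorem tensor_one : tensor (fun _ : Fin n => (1 : Matrix (Fin 2) (Fin 2) ℂ)) = 1 := by
  ext x y
  simp only [tensor, Matrix.of_apply, Matrix.one_apply, Finset.prod_ite_zero, Finset.prod_const_one,
    Finset.mem_univ, true_imp_iff, funext_iff]

theorem tensor_mul_eq_neg (P Q : Fin n → Matrix (Fin 2) (Fin 2) ℂ) (j : Fin n)
    (hj : P j * Q j = -(Q j * P j)) (h : ∀ k, k ≠ j → P k * Q k = Q k * P k) :
    tensor P * tensor Q = -(tensor Q * tensor P) := by
  rw [tensor_mul, tensor_mul]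
  ext x y
  simp only [tensor, Matrix.of_apply, Matrix.neg_apply]
  rw [← Finset.mul_prod_erase _ _ (Finset.mem_univ j),
    ← Finset.mul_prod_erase Finset.univ (fun k => (Q k * P k) (x k) (y k)) (Finset.mem_univ j), hj,
    Matrix.neg_apply, neg_mul]
  congr 2
  refine Finset.prod_congr rfl fun k hk => ?_
  rw [h k (Finset.ne_of_mem_erase hk)]

theorem pauliX_sq : pauliX * pauliX = 1 := by
  ext i j; fin_cases i <;> fin_cases j <;> simp [pauliX]

theorem pauliY_sq : pauliY * pauliY = 1 := by
  ext i j; fin_cases i <;> fin_cases j <;> simp [pauliY]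

theorem pauliZ_sq : pauliZ * pauliZ = 1 := by
  ext i j; fin_cases i <;> fin_cases j <;> simp [pauliZ]

theorem pauliX_mul_pauliY : pauliX * pauliY = -(pauliY * pauliX) := by
  ext i j; fin_cases i <;> fin_cases j <;> simp [pauliX, pauliY]

theorem pauliX_mul_pauliZ : pauliX * pauliZ = -(pauliZ * pauliX) := by
  ext i j; fin_cases i <;> fin_cases j <;> simp [pauliX, pauliZ]

theorem pauliY_mul_pauliZ : pauliY * pauliZ = -(pauliZ * pauliY) := by
  ext i j; fin_cases i <;> fin_cases j <;> simp [pauliZ, pauliY]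

theorem pauliX_conjTranspose : pauliXᴴ = pauliX := by
  ext i j; fin_cases i <;> fin_cases j <;> simp [pauliX]

theorem pauliY_conjTranspose : pauliYᴴ = pauliY := by
  ext i j; fin_cases i <;> fin_cases j <;> simp [pauliY]

theorem pauliZ_conjTranspose : pauliZᴴ = pauliZ := by
  ext i j; fin_cases i <;> fin_cases j <;> simp [pauliZ]

theorem majorana_conjTranspose (a : Fin (2 * n)) : (majorana a)ᴴ = majorana a := by
  rw [majorana, tensor_conjTranspose]
  congr 1
  ext1 k
  split_ifs <;>
    simp [pauliX_conjTranspose, pauliY_conjTranspose, pauliZ_conjTranspose]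

theorem majorana_sq (a : Fin (2 * n)) : majorana a * majorana a = 1 := by
  rw [majorana, tensor_mul, ← tensor_one]
  congr 1
  ext1 k
  split_ifs <;> simp [pauliX_sq, pauliY_sq, pauliZ_sq]

theorem majorana_mul_of_lt {a b : Fin (2 * n)} (h : a < b) :
    majorana a * majorana b = -(majorana b * majorana a) := by
  have hab : (a : ℕ) < b := h
  have ha : (a : ℕ) / 2 < n := by omega
  -- The only site with anticommuting factors is that of the smaller label: there `X` or `Y` meets
  -- `Z`, or `X` meets `Y` if both labels share the site.
  refine tensor_mul_eq_neg _ _ ⟨(a : ℕ) / 2, ha⟩ ?_ fun k hk => ?_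
  · simp only [lt_irrefl, if_false, if_true]
    rcases Nat.lt_or_ge ((a : ℕ) / 2) ((b : ℕ) / 2) with hlt | hge
    · rw [if_pos hlt]
      split_ifs
      exacts [pauliX_mul_pauliZ, pauliY_mul_pauliZ]
    · have he : (a : ℕ) / 2 = (b : ℕ) / 2 := by omega
      rw [if_neg (by omega : ¬(a : ℕ) / 2 < (b : ℕ) / 2), if_pos he,
        if_pos (by omega : (a : ℕ) % 2 = 0), if_neg (by omega : ¬(b : ℕ) % 2 = 0)]
      exact pauliX_mul_pauliY
  · have hk' : (k : ℕ) ≠ (a : ℕ) / 2 := fun e => hk (Fin.ext e)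
    rw [if_neg hk']
    rcases lt_or_gt_of_ne hk' with h1 | h1
    · rw [if_pos h1, if_pos (by omega)]
    · rw [if_neg (by omega), one_mul, mul_one]

theorem majorana_mul_of_ne {a b : Fin (2 * n)} (h : a ≠ b) :
    majorana a * majorana b = -(majorana b * majorana a) := by
  rcases lt_or_gt_of_ne h with h | h
  · exact majorana_mul_of_lt h
  · rw [majorana_mul_of_lt h, neg_neg]

/-- The canonical anticommutation relations. -/
theorem majorana_anticomm (a b : Fin (2 * n)) :
    majorana a * majorana b + majorana b * majorana a = if a = b then 2 else 0 := by
  split_ifs with h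
  · rw [h, majorana_sq, one_add_one_eq_two]
  · rw [majorana_mul_of_ne h, neg_add_cancel]

/-- The fermionic parity operator. -/
def parity (n : ℕ) : Op n := tensor fun _ => pauliZ

theorem parity_sq : parity n * parity n = 1 := by
  rw [parity, tensor_mul, ← tensor_one]
  simp only [pauliZ_sq]

theorem majorana_mul_parity (a : Fin (2 * n)) :
    majorana a * parity n = -(parity n * majorana a) := by
  have ha : (a : ℕ) / 2 < n := by omega
  refine tensor_mul_eq_neg _ _ ⟨(a : ℕ) / 2, ha⟩ ?_ fun k hk => ?_
  · simp only [lt_irrefl, if_false, if_true]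
    split_ifs
    exacts [pauliX_mul_pauliZ, pauliY_mul_pauliZ]
  · have hk' : (k : ℕ) ≠ (a : ℕ) / 2 := fun e => hk (Fin.ext e)
    rw [if_neg hk']
    split_ifs
    · rfl
    · rw [one_mul, mul_one]

/-! ### Rank-one operators -/

theorem ketbra_eq_vecMulVec (ψ : Ket n) : ketbra ψ = Matrix.vecMulVec ψ.ofLp (star ψ.ofLp) := by
  ext x y; simp [ketbra, Matrix.vecMulVec_apply]

theorem ketbra_conjTranspose (ψ : Ket n) : (ketbra ψ)ᴴ = ketbra ψ := by
  ext x y; simp [ketbra, mul_comm]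

theorem trace_ketbra_mul (ψ : Ket n) (A : Op n) :
    (ketbra ψ * A).trace = star ψ.ofLp ⬝ᵥ A *ᵥ ψ.ofLp := by
  rw [ketbra_eq_vecMulVec, Matrix.trace_mul_comm, Matrix.mul_vecMulVec, Matrix.trace_vecMulVec,
    dotProduct_comm]

theorem ketbra_mul_mul_ketbra (ψ : Ket n) (A : Op n) :
    ketbra ψ * A * ketbra ψ = (ketbra ψ * A).trace • ketbra ψ := by
  rw [trace_ketbra_mul, ketbra_eq_vecMulVec, mul_assoc, Matrix.mul_vecMulVec,
    Matrix.vecMulVec_mul_vecMulVec, Matrix.vecMulVec_smul]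

theorem star_dotProduct_self (ψ : Ket n) : star ψ.ofLp ⬝ᵥ ψ.ofLp = ((‖ψ‖ ^ 2 : ℝ) : ℂ) := by
  have := inner_self_eq_norm_sq_to_K (𝕜 := ℂ) ψ
  rw [EuclideanSpace.inner_eq_star_dotProduct, dotProduct_comm] at this
  rw [this]; simp

theorem trace_ketbra {ψ : Ket n} (hψ : ‖ψ‖ = 1) : (ketbra ψ).trace = 1 := by
  have := trace_ketbra_mul ψ 1
  rw [mul_one, Matrix.one_mulVec, star_dotProduct_self, hψ] at this
  simpa using this

theorem ketbra_mul_self {ψ : Ket n} (hψ : ‖ψ‖ = 1) : ketbra ψ * ketbra ψ = ketbra ψ := by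
  have := ketbra_mul_mul_ketbra ψ 1
  rwa [mul_one, trace_ketbra hψ, one_smul] at this

theorem star_trace_ketbra_mul (ψ : Ket n) (A : Op n) :
    star (ketbra ψ * A).trace = (ketbra ψ * Aᴴ).trace := by
  rw [← Matrix.trace_conjTranspose, Matrix.conjTranspose_mul, ketbra_conjTranspose,
    Matrix.trace_mul_comm]

theorem covariance_eq_im (ψ : Ket n) (a b : Fin (2 * n)) :
    covariance (ketbra ψ) a b = (ketbra ψ * (majorana a * majorana b)).trace.im := by
  have h := star_trace_ketbra_mul ψ (majorana a * majorana b)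
  rw [Matrix.conjTranspose_mul, majorana_conjTranspose, majorana_conjTranspose] at h
  simp only [covariance, Matrix.of_apply]
  rw [mul_sub, Matrix.trace_sub, ← h]
  simp
  ring

/-- The adjoint swaps the two factors, so the anticommutator fixes the real part and the commutator
the imaginary part. -/
theorem trace_ketbra_mul_majorana_mul {ψ : Ket n} (hψ : ‖ψ‖ = 1) (a b : Fin (2 * n)) :
    (ketbra ψ * (majorana a * majorana b)).trace =
      (if a = b then 1 else 0) + Complex.I * covariance (ketbra ψ) a b := by
  have h := star_trace_ketbra_mul ψ (majorana a * majorana b)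
  rw [Matrix.conjTranspose_mul, majorana_conjTranspose, majorana_conjTranspose] at h
  have h2 : (ketbra ψ * (majorana a * majorana b)).trace +
      (ketbra ψ * (majorana b * majorana a)).trace = if a = b then 2 else 0 := by
    rw [← Matrix.trace_add, ← mul_add, majorana_anticomm]
    split_ifs
    · rw [mul_two, Matrix.trace_add, trace_ketbra hψ, one_add_one_eq_two]
    · simp
  rw [← h] at h2
  rw [covariance_eq_im]
  have h3 := congrArg Complex.re h2
  apply Complex.ext
  · simp only [Complex.star_def, Complex.add_re, Complex.conj_re] at h3
    simp
    split_ifs at h3 ⊢ <;> simp at h3 ⊢ <;> linarith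
  · split_ifs <;> simp

theorem covariance_transpose (ρ : Op n) : (covariance ρ)ᵀ = -covariance ρ := by
  ext a b
  simp only [covariance, Matrix.transpose_apply, Matrix.neg_apply, Matrix.of_apply]
  rw [← neg_sub (majorana a * majorana b), mul_neg, Matrix.trace_neg, mul_neg, Complex.neg_re]

theorem covariance_self (ρ : Op n) (a : Fin (2 * n)) : covariance ρ a a = 0 := by
  simp [covariance]

theorem FAF_one (ρ : Op n) :
    FAF 1 ρ = n - 1 / 2 * ∑ a, ∑ b, covariance ρ a b ^ 2 := by
  have h : -(covariance ρ ^ 2) = covariance ρ * (covariance ρ)ᵀ := by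
    rw [covariance_transpose, mul_neg, pow_two]
  rw [FAF, pow_one, h, Matrix.trace]
  simp [Matrix.mul_apply, pow_two]

/-! ### Linear combinations of Majorana operators -/

/-- The linear combination of the Majorana operators with coefficients `u`. -/
def lin (u : Fin (2 * n) → ℝ) : Op n := ∑ a, (u a : ℂ) • majorana a

theorem lin_conjTranspose (u : Fin (2 * n) → ℝ) : (lin u)ᴴ = lin u := by
  simp [lin, Matrix.conjTranspose_sum, Matrix.conjTranspose_smul, majorana_conjTranspose]

theorem lin_mul_lin (u v : Fin (2 * n) → ℝ) :
    lin u * lin v = ∑ a, ∑ b, ((u a : ℂ) * v b) • (majorana a * majorana b) := by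
  simp only [lin, Finset.sum_mul_sum, smul_mul_smul_comm]

/-- Basis-free Clifford relation: orthonormal real vectors give operators that behave like Majorana
operators, so no unitary implementing a rotation is needed. -/
theorem lin_anticomm (u v : Fin (2 * n) → ℝ) :
    lin u * lin v + lin v * lin u = ((2 * (u ⬝ᵥ v) : ℝ) : ℂ) • (1 : Op n) := by
  rw [lin_mul_lin u v, lin_mul_lin v u, Finset.sum_comm (γ := Fin (2 * n))
    (f := fun a b => ((v a : ℂ) * u b) • (majorana a * majorana b)), ← Finset.sum_add_distrib]
  simp only [← Finset.sum_add_distrib, mul_comm (v _ : ℂ), ← smul_add, majorana_anticomm, smul_ite,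
    smul_zero, Finset.sum_ite_eq, Finset.mem_univ, if_true]
  have h2 : (2 : Op n) = (2 : ℂ) • 1 := by rw [two_smul, one_add_one_eq_two]
  rw [← Finset.sum_smul, dotProduct, h2, smul_smul]
  congr 1
  push_cast
  ring

theorem lin_sq {u : Fin (2 * n) → ℝ} (hu : u ⬝ᵥ u = 1) : lin u * lin u = 1 := by
  have h := lin_anticomm u u
  rw [hu, ← two_smul ℂ] at h
  have h2 : (2 : ℂ) ≠ 0 := two_ne_zero
  have := congrArg (fun A => (2 : ℂ)⁻¹ • A) h
  simpa [smul_smul] using this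

theorem lin_mul_lin_of_orthogonal {u v : Fin (2 * n) → ℝ} (h : u ⬝ᵥ v = 0) :
    lin u * lin v = -(lin v * lin u) := by
  have := lin_anticomm u v
  rw [h] at this
  rw [eq_neg_iff_add_eq_zero, this]; simp

theorem trace_ketbra_mul_lin_mul_lin {ψ : Ket n} (hψ : ‖ψ‖ = 1) (u v : Fin (2 * n) → ℝ) :
    (ketbra ψ * (lin u * lin v)).trace =
      (u ⬝ᵥ v : ℝ) + Complex.I * (u ⬝ᵥ covariance (ketbra ψ) *ᵥ v : ℝ) := by
  rw [lin_mul_lin, Finset.mul_sum, Matrix.trace_sum]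
  simp only [Finset.mul_sum, Matrix.trace_sum, Matrix.mul_smul, Matrix.trace_smul,
    trace_ketbra_mul_majorana_mul hψ, smul_eq_mul, mul_add, Finset.sum_add_distrib,
    dotProduct, Matrix.mulVec, Complex.ofReal_sum, Complex.ofReal_mul]
  congr 1
  · simp
  · refine Finset.sum_congr rfl fun a _ => Finset.sum_congr rfl fun b _ => ?_
    ring

/-- The quadratic Majorana observable `-i u(γ) v(γ)`. -/
def bilin (u v : Fin (2 * n) → ℝ) : Op n := (-Complex.I) • (lin u * lin v)

theorem bilin_conjTranspose {u v : Fin (2 * n) → ℝ} (h : u ⬝ᵥ v = 0) :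
    (bilin u v)ᴴ = bilin u v := by
  rw [bilin, Matrix.conjTranspose_smul, Matrix.conjTranspose_mul, lin_conjTranspose,
    lin_conjTranspose, lin_mul_lin_of_orthogonal h]
  simp

theorem bilin_sq {u v : Fin (2 * n) → ℝ} (h : u ⬝ᵥ v = 0) (hu : u ⬝ᵥ u = 1) (hv : v ⬝ᵥ v = 1) :
    bilin u v * bilin u v = 1 := by
  have : lin u * lin v * (lin u * lin v) = -1 := by
    rw [lin_mul_lin_of_orthogonal h]
    calc -(lin v * lin u) * -(lin v * lin u) = lin v * (lin u * lin v) * lin u := by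
          noncomm_ring
      _ = -((lin v * lin v) * (lin u * lin u)) := by
          rw [lin_mul_lin_of_orthogonal h]; noncomm_ring
      _ = -1 := by rw [lin_sq hu, lin_sq hv, mul_one]
  rw [bilin, smul_mul_smul_comm, this]
  simp

theorem trace_ketbra_mul_bilin {ψ : Ket n} (hψ : ‖ψ‖ = 1) {u v : Fin (2 * n) → ℝ}
    (h : u ⬝ᵥ v = 0) :
    (ketbra ψ * bilin u v).trace = (u ⬝ᵥ covariance (ketbra ψ) *ᵥ v : ℝ) := by
  rw [bilin, Matrix.mul_smul, Matrix.trace_smul, trace_ketbra_mul_lin_mul_lin hψ, h, smul_eq_mul,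
    Complex.ofReal_zero, zero_add, ← mul_assoc]
  simp

/-! ### Pure Gaussian states -/

section Kronecker

open scoped Kronecker

/-- The operator `∑ γ_c ⊗ γ_c` on two copies of the system. -/
def majoranaPair (n : ℕ) : Matrix (Bits n × Bits n) (Bits n × Bits n) ℂ :=
  ∑ c, majorana c ⊗ₖ majorana c

/-- The ring homomorphism `A ↦ A ⊗ 1`. -/
def kroneckerLeft (n : ℕ) : Op n →+* Matrix (Bits n × Bits n) (Bits n × Bits n) ℂ where
  toFun A := A ⊗ₖ 1
  map_one' := Matrix.one_kronecker_one
  map_mul' A B := by rw [← Matrix.mul_kronecker_mul, one_mul]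
  map_zero' := Matrix.zero_kronecker _
  map_add' A B := Matrix.add_kronecker _ _ _

/-- The ring homomorphism `A ↦ 1 ⊗ A`. -/
def kroneckerRight (n : ℕ) : Op n →+* Matrix (Bits n × Bits n) (Bits n × Bits n) ℂ where
  toFun A := 1 ⊗ₖ A
  map_one' := Matrix.one_kronecker_one
  map_mul' A B := by rw [← Matrix.mul_kronecker_mul, one_mul]
  map_zero' := Matrix.kronecker_zero _
  map_add' A B := Matrix.kronecker_add _ _ _

theorem continuous_kronecker : Continuous fun A : Op n × Op n => A.1 ⊗ₖ A.2 := by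
  exact continuous_matrix fun i j =>
    (continuous_fst.matrix_elem i.1 j.1).mul (continuous_snd.matrix_elem i.2 j.2)

open scoped Matrix.Norms.Operator in
theorem exp_kronecker_exp (A : Op n) :
    NormedSpace.exp A ⊗ₖ NormedSpace.exp A =
      NormedSpace.exp (A ⊗ₖ (1 : Op n) + (1 : Op n) ⊗ₖ A) := by
  have hl : NormedSpace.exp A ⊗ₖ (1 : Op n) = NormedSpace.exp (A ⊗ₖ (1 : Op n)) :=
    NormedSpace.map_exp (kroneckerLeft n)
      (continuous_kronecker.comp (continuous_id.prodMk continuous_const)) A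
  have hr : (1 : Op n) ⊗ₖ NormedSpace.exp A = NormedSpace.exp ((1 : Op n) ⊗ₖ A) :=
    NormedSpace.map_exp (kroneckerRight n)
      (continuous_kronecker.comp (continuous_const.prodMk continuous_id)) A
  rw [Matrix.exp_add_of_commute, ← hl, ← hr, ← Matrix.mul_kronecker_mul, mul_one, one_mul]
  rw [Commute, SemiconjBy, ← Matrix.mul_kronecker_mul, ← Matrix.mul_kronecker_mul]
  simp

/-- The commutator with a quadratic monomial keeps the span of the Majorana operators, acting there
as an infinitesimal rotation. -/
theorem majorana_mul_mul_sub (a b c : Fin (2 * n)) :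
    majorana a * majorana b * majorana c - majorana c * (majorana a * majorana b) =
      (if b = c then (2 : ℂ) • majorana a else 0) - (if a = c then (2 : ℂ) • majorana b else 0) := by
  have h1 := congrArg (majorana a * ·) (majorana_anticomm b c)
  have h2 := congrArg (· * majorana b) (majorana_anticomm a c)
  beta_reduce at h1 h2
  have h3 : (if b = c then (2 : ℂ) • majorana a else 0) =
      majorana a * (if b = c then 2 else 0) := by
    split_ifs
    · rw [mul_two, two_smul]
    · rw [mul_zero]
  have h4 : (if a = c then (2 : ℂ) • majorana b else 0) =
      (if a = c then 2 else 0) * majorana b := by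
    split_ifs
    · rw [two_mul, two_smul]
    · rw [zero_mul]
  rw [h3, h4, ← h1, ← h2]
  noncomm_ring

/-- The tensor `∑ γ_c ⊗ γ_c` is rotation invariant: the four terms left after summing over `c`
cancel in pairs. -/
theorem commute_majorana_mul_majoranaPair (a b : Fin (2 * n)) :
    Commute ((majorana a * majorana b) ⊗ₖ (1 : Op n) + (1 : Op n) ⊗ₖ (majorana a * majorana b))
      (majoranaPair n) := by
  rw [Commute, SemiconjBy, ← sub_eq_zero, majoranaPair, Finset.mul_sum, Finset.sum_mul,
    ← Finset.sum_sub_distrib]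
  have key : ∀ c : Fin (2 * n),
      ((majorana a * majorana b) ⊗ₖ (1 : Op n) + (1 : Op n) ⊗ₖ (majorana a * majorana b)) *
        (majorana c ⊗ₖ majorana c) - (majorana c ⊗ₖ majorana c) *
        ((majorana a * majorana b) ⊗ₖ (1 : Op n) + (1 : Op n) ⊗ₖ (majorana a * majorana b)) =
      ((if b = c then ((2 : ℂ) • majorana a) ⊗ₖ majorana c else 0) -
        (if a = c then ((2 : ℂ) • majorana b) ⊗ₖ majorana c else 0)) +
      ((if b = c then majorana c ⊗ₖ ((2 : ℂ) • majorana a) else 0) -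
        (if a = c then majorana c ⊗ₖ ((2 : ℂ) • majorana b) else 0)) := by
    intro c
    have e1 := congrArg (fun A => A ⊗ₖ majorana c) (majorana_mul_mul_sub a b c)
    have e2 := congrArg (fun A => majorana c ⊗ₖ A) (majorana_mul_mul_sub a b c)
    simp only [sub_eq_add_neg, Matrix.add_kronecker, Matrix.kronecker_add] at e1 e2
    simp only [add_mul, mul_add, ← Matrix.mul_kronecker_mul, one_mul, mul_one, sub_eq_add_neg]
    have n1 : ∀ A B : Op n, (-A) ⊗ₖ B = -(A ⊗ₖ B) := fun A B => by
      ext; simp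
    have n2 : ∀ A B : Op n, A ⊗ₖ (-B) = -(A ⊗ₖ B) := fun A B => by
      ext; simp
    simp only [n1, n2] at e1 e2
    have i1 : ∀ (p : Prop) [Decidable p] (A B : Op n),
        (if p then A else 0) ⊗ₖ B = if p then A ⊗ₖ B else 0 := fun p _ A B => by
      split_ifs <;> simp
    have i2 : ∀ (p : Prop) [Decidable p] (A B : Op n),
        B ⊗ₖ (if p then A else 0) = if p then B ⊗ₖ A else 0 := fun p _ A B => by
      split_ifs <;> simp
    simp only [i1, i2] at e1 e2
    rw [← e1, ← e2]
    abel
  rw [Finset.sum_congr rfl fun c _ => key c]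
  simp only [Finset.sum_add_distrib, Finset.sum_sub_distrib, Finset.sum_ite_eq, Finset.mem_univ,
    if_true, Matrix.smul_kronecker, Matrix.kronecker_smul]
  abel

theorem commute_gaussianExp_kronecker (K : Matrix (Fin (2 * n)) (Fin (2 * n)) ℝ) :
    Commute (gaussianExp K ⊗ₖ gaussianExp K) (majoranaPair n) := by
  rw [gaussianExp, exp_kronecker_exp]
  refine Commute.exp_left ?_
  -- Linearity of the generator on two copies reduces the claim to single monomials.
  let D : Op n →ₗ[ℂ] Matrix (Bits n × Bits n) (Bits n × Bits n) ℂ :=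
    { toFun := fun A => A ⊗ₖ (1 : Op n) + (1 : Op n) ⊗ₖ A
      map_add' := fun A B => by rw [Matrix.add_kronecker, Matrix.kronecker_add]; abel
      map_smul' := fun c A => by
        rw [Matrix.smul_kronecker, Matrix.kronecker_smul, smul_add, RingHom.id_apply] }
  change Commute (D _) _
  rw [map_smul, map_sum]
  refine Commute.smul_left (Commute.sum_left _ _ _ fun a _ => ?_) _
  rw [map_sum]
  refine Commute.sum_left _ _ _ fun b _ => ?_
  split_ifs
  · rw [map_smul]
    exact Commute.smul_left (commute_majorana_mul_majoranaPair a b) _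
  · rw [map_zero]
    exact Commute.zero_left _

theorem commute_parity_gaussianExp (K : Matrix (Fin (2 * n)) (Fin (2 * n)) ℝ) :
    Commute (gaussianExp K) (parity n) := by
  rw [gaussianExp]
  refine Commute.exp_left (Commute.smul_left
    (Commute.sum_left _ _ _ fun a _ => Commute.sum_left _ _ _ fun b _ => ?_) _)
  split_ifs
  · refine Commute.smul_left ?_ _
    rw [Commute, SemiconjBy, mul_assoc, majorana_mul_parity, mul_neg, ← mul_assoc,
      majorana_mul_parity, neg_mul, neg_neg, mul_assoc]
  · exact Commute.zero_left _

/-- Commutation is a closed condition on `ρ`, so it survives the limits that produce the pure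
states. -/
theorem IsGaussian.commute_kronecker {ρ : Op n} (h : IsGaussian ρ) :
    Commute (ρ ⊗ₖ ρ) (majoranaPair n) := by
  have hc : IsClosed {σ : Op n | Commute (σ ⊗ₖ σ) (majoranaPair n)} := by
    have hk : Continuous fun σ : Op n => σ ⊗ₖ σ :=
      continuous_kronecker.comp (continuous_id.prodMk continuous_id)
    exact isClosed_eq (hk.mul continuous_const) (continuous_const.mul hk)
  refine closure_minimal ?_ hc h
  rintro σ ⟨K, -, rfl⟩
  change Commute _ _
  rw [gaussianState, Matrix.smul_kronecker, Matrix.kronecker_smul]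
  exact ((commute_gaussianExp_kronecker K).smul_left _).smul_left _

theorem IsGaussian.commute_parity {ρ : Op n} (h : IsGaussian ρ) : Commute ρ (parity n) := by
  have hc : IsClosed {σ : Op n | Commute σ (parity n)} :=
    isClosed_eq (continuous_id.mul continuous_const) (continuous_const.mul continuous_id)
  refine closure_minimal ?_ hc h
  rintro σ ⟨K, -, rfl⟩
  exact (commute_parity_gaussianExp K).smul_left _

theorem IsGaussian.trace_mul_majorana {ρ : Op n} (h : IsGaussian ρ) (a : Fin (2 * n)) :
    (ρ * majorana a).trace = 0 := by
  have h1 : (ρ * majorana a).trace = -(ρ * majorana a).trace := by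
    calc (ρ * majorana a).trace = (parity n * (parity n * (ρ * majorana a))).trace := by
          rw [← mul_assoc, parity_sq, one_mul]
      _ = (parity n * (ρ * majorana a) * parity n).trace := Matrix.trace_mul_comm _ _
      _ = -(ρ * majorana a).trace := by
          rw [← mul_assoc, ← h.commute_parity.eq, mul_assoc, mul_assoc, majorana_mul_parity,
            mul_neg, ← mul_assoc (parity n), parity_sq, one_mul, mul_neg, Matrix.trace_neg]
  exact self_eq_neg.mp h1

/-- The covariance matrix of a pure Gaussian state has rows of norm one. -/
theorem sum_covariance_sq_of_mem_pureGaussian {φ : Ket n} (hφ : φ ∈ pureGaussian n)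
    (b : Fin (2 * n)) : ∑ a, covariance (ketbra φ) b a ^ 2 = 1 := by
  obtain ⟨h1, hG⟩ := hφ
  set P := ketbra φ with hP
  have hc := hG.commute_kronecker
  -- Trace the commutation relation against `(P γ_b) ⊗ (P γ_b)`. The left side vanishes by parity,
  -- as `P γ_a P = tr(P γ_a) P`; the right side is `∑ (δ_{ba} + i Γ_{ba})² = 1 - ∑ Γ_{ba}²`.
  have ht : ∑ a, (P * majorana a * (P * majorana b)).trace ^ 2 =
      ∑ a, (majorana a * P * (P * majorana b)).trace ^ 2 := by
    have := congrArg (fun M => (M * ((P * majorana b) ⊗ₖ (P * majorana b))).trace) hc.eq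
    simpa only [majoranaPair, Finset.mul_sum, Finset.sum_mul, ← Matrix.mul_kronecker_mul,
      Matrix.trace_sum, Matrix.trace_kronecker, ← pow_two] using this
  have hl : ∀ a, (P * majorana a * (P * majorana b)).trace = 0 := fun a => by
    rw [← mul_assoc, ketbra_mul_mul_ketbra, hG.trace_mul_majorana, zero_smul, zero_mul,
      Matrix.trace_zero]
  have hr : ∀ a, (majorana a * P * (P * majorana b)).trace =
      (if b = a then 1 else 0) + Complex.I * covariance P b a := fun a => by
    rw [← trace_ketbra_mul_majorana_mul h1, mul_assoc, ← mul_assoc P P, ketbra_mul_self h1,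
      Matrix.trace_mul_comm, mul_assoc]
  simp only [hl, hr, add_sq, mul_pow, Complex.I_sq, Finset.sum_add_distrib] at ht
  have hd : ∀ a, (2 : ℂ) * (if b = a then 1 else 0) * (Complex.I * covariance P b a) = 0 := by
    intro a
    split_ifs with e
    · rw [← e, covariance_self]; simp
    · simp
  simp only [hd] at ht
  have h2 : (1 : ℂ) = ∑ a, (covariance P b a : ℂ) ^ 2 := by
    simp at ht
    linear_combination -ht
  exact_mod_cast h2.symm

end Kronecker

/-! ### The trace distance of pure states -/

/-- The overlap `|⟨φ|ψ⟩|²` of two state vectors. -/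
def overlap (φ ψ : Ket n) : ℝ := (ketbra φ * ketbra ψ).trace.re

theorem trace_ketbra_mul_ketbra (φ ψ : Ket n) :
    (ketbra φ * ketbra ψ).trace = (overlap φ ψ : ℂ) := by
  have h := star_trace_ketbra_mul φ (ketbra ψ)
  rw [ketbra_conjTranspose] at h
  exact (Complex.conj_eq_iff_re.mp h).symm

theorem overlap_comm (φ ψ : Ket n) : overlap φ ψ = overlap ψ φ := by
  rw [overlap, Matrix.trace_mul_comm, overlap]

theorem eigenvalues_sq_of_mul_self {m : Type*} [Fintype m] [DecidableEq m] {B : Matrix m m ℂ}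
    (hB : B.IsHermitian) {r : ℝ} (h : B * B = (r : ℂ) • B) (i : m) :
    hB.eigenvalues i * hB.eigenvalues i = r * hB.eigenvalues i := by
  have hv := hB.mulVec_eigenvectorBasis i
  have h2 := congrArg (fun M => M *ᵥ (hB.eigenvectorBasis i).ofLp) h
  simp only [← Matrix.mulVec_mulVec, hv, Matrix.mulVec_smul, Matrix.smul_mulVec] at h2
  have hne : (hB.eigenvectorBasis i).ofLp ≠ 0 := fun h0 =>
    hB.eigenvectorBasis.orthonormal.ne_zero i (by ext x; exact congrFun h0 x)
  obtain ⟨x, hx⟩ := Function.ne_iff.mp hne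
  have h3 := congrFun h2 x
  simp only [Pi.smul_apply, Complex.real_smul, smul_eq_mul, ← mul_assoc] at h3
  exact_mod_cast mul_right_cancel₀ hx h3

/-- The first relation puts the eigenvalues of `Aᴴ A` in `{0, s²}`; for `s > 0` the trace makes
exactly two of them nonzero. -/
theorem traceNorm_eq_of_mul_self {A : Op n} {s : ℝ} (hs : 0 ≤ s)
    (h : Aᴴ * A * (Aᴴ * A) = ((s ^ 2 : ℝ) : ℂ) • (Aᴴ * A))
    (ht : (Aᴴ * A).trace = ((2 * s ^ 2 : ℝ) : ℂ)) :
    traceNorm A = 2 * s := by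
  set hB := Matrix.isHermitian_conjTranspose_mul_self A
  have hev := eigenvalues_sq_of_mul_self hB h
  have hsum : ∑ i, hB.eigenvalues i = 2 * s ^ 2 := by
    have := hB.trace_eq_sum_eigenvalues
    rw [ht] at this
    apply Complex.ofReal_injective
    rw [this]
    simp
  have hnn : ∀ i, 0 ≤ hB.eigenvalues i := (Matrix.posSemidef_conjTranspose_mul_self A).eigenvalues_nonneg
  rcases hs.eq_or_lt with rfl | hpos
  · rw [traceNorm, mul_zero]
    refine Finset.sum_eq_zero fun i _ => ?_
    have := hev i
    rw [zero_pow two_ne_zero, zero_mul, mul_self_eq_zero] at this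
    rw [this, Real.sqrt_zero]
  · have hsq : ∀ i, s * √(hB.eigenvalues i) = hB.eigenvalues i := by
      intro i
      rcases (hnn i).eq_or_lt with h0 | h0
      · rw [← h0, Real.sqrt_zero, mul_zero]
      · have h1 : hB.eigenvalues i = s ^ 2 := mul_right_cancel₀ h0.ne' (hev i)
        rw [h1, Real.sqrt_sq hs, pow_two]
    have : s * traceNorm A = s * (2 * s) := by
      rw [traceNorm, Finset.mul_sum, Finset.sum_congr rfl fun i _ => hsq i, hsum]
      ring
    exact mul_left_cancel₀ hpos.ne' this

theorem ketbra_sub_mul_self {ψ φ : Ket n} (hψ : ‖ψ‖ = 1) (hφ : ‖φ‖ = 1) :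
    (ketbra ψ - ketbra φ) * (ketbra ψ - ketbra φ) =
      ketbra ψ + ketbra φ - ketbra ψ * ketbra φ - ketbra φ * ketbra ψ := by
  rw [sub_mul, mul_sub, mul_sub, ketbra_mul_self hψ, ketbra_mul_self hφ]
  abel

/-- The algebraic form of the fact that the nonzero eigenvalues of the difference are `±√(1 - F)`.
-/
theorem ketbra_sub_pow_three {ψ φ : Ket n} (hψ : ‖ψ‖ = 1) (hφ : ‖φ‖ = 1) :
    (ketbra ψ - ketbra φ) * ((ketbra ψ - ketbra φ) * (ketbra ψ - ketbra φ)) =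
      ((1 - overlap ψ φ : ℝ) : ℂ) • (ketbra ψ - ketbra φ) := by
  have h1 := ketbra_mul_mul_ketbra ψ (ketbra φ)
  have h2 := ketbra_mul_mul_ketbra φ (ketbra ψ)
  rw [trace_ketbra_mul_ketbra] at h1 h2
  rw [overlap_comm φ ψ] at h2
  rw [ketbra_sub_mul_self hψ hφ]
  simp only [sub_mul, mul_sub, mul_add, ← mul_assoc, h1, h2, ketbra_mul_self hψ,
    ketbra_mul_self hφ]
  push_cast
  module

theorem trace_ketbra_sub_mul_self {ψ φ : Ket n} (hψ : ‖ψ‖ = 1) (hφ : ‖φ‖ = 1) :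
    ((ketbra ψ - ketbra φ) * (ketbra ψ - ketbra φ)).trace =
      ((2 * (1 - overlap ψ φ) : ℝ) : ℂ) := by
  rw [ketbra_sub_mul_self hψ hφ]
  simp only [Matrix.trace_add, Matrix.trace_sub, trace_ketbra hψ, trace_ketbra hφ,
    trace_ketbra_mul_ketbra, overlap_comm φ ψ]
  push_cast
  ring

theorem overlap_le_one {ψ φ : Ket n} (hψ : ‖ψ‖ = 1) (hφ : ‖φ‖ = 1) : overlap ψ φ ≤ 1 := by
  have h := (Matrix.posSemidef_conjTranspose_mul_self (ketbra ψ - ketbra φ)).trace_nonneg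
  rw [Matrix.conjTranspose_sub, ketbra_conjTranspose, ketbra_conjTranspose,
    trace_ketbra_sub_mul_self hψ hφ, Complex.zero_le_real] at h
  linarith

theorem traceDist_ketbra {ψ φ : Ket n} (hψ : ‖ψ‖ = 1) (hφ : ‖φ‖ = 1) :
    traceDist (ketbra ψ) (ketbra φ) = √(1 - overlap ψ φ) := by
  have hle : 0 ≤ 1 - overlap ψ φ := sub_nonneg.mpr (overlap_le_one hψ hφ)
  have hA : (ketbra ψ - ketbra φ)ᴴ = ketbra ψ - ketbra φ := by
    rw [Matrix.conjTranspose_sub, ketbra_conjTranspose, ketbra_conjTranspose]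
  rw [traceDist, traceNorm_eq_of_mul_self (Real.sqrt_nonneg (1 - overlap ψ φ))]
  · ring
  · rw [hA, Real.sq_sqrt hle, mul_assoc, ketbra_sub_pow_three hψ hφ, Matrix.mul_smul]
  · rw [hA, Real.sq_sqrt hle, trace_ketbra_sub_mul_self hψ hφ]

/-! ### Lower bound -/

/-- If a Hermitian idempotent fixes the state `φ`, its expectation in `ψ` is at least the overlap
of `φ` and `ψ`. -/
theorem overlap_le_of_fixes {ψ φ : Ket n} (hφ : ‖φ‖ = 1) {p : Op n} (hp : p.IsHermitian)
    (hpp : p * p = p) (hfix : p * ketbra φ = ketbra φ) :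
    overlap ψ φ ≤ (ketbra ψ * p).trace.re := by
  have hfix' : ketbra φ * p = ketbra φ := by
    have := congrArg Matrix.conjTranspose hfix
    rwa [Matrix.conjTranspose_mul, ketbra_conjTranspose, hp.eq] at this
  -- The difference is itself a projector, hence positive.
  have hq : (p - ketbra φ)ᴴ * (p - ketbra φ) = p - ketbra φ := by
    rw [Matrix.conjTranspose_sub, ketbra_conjTranspose, hp.eq, sub_mul, mul_sub, mul_sub, hpp, hfix,
      hfix', ketbra_mul_self hφ]
    abel
  have h := (Matrix.posSemidef_conjTranspose_mul_self (p - ketbra φ)).dotProduct_mulVec_nonneg ψ.ofLp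
  rw [hq, ← trace_ketbra_mul, mul_sub, Matrix.trace_sub, trace_ketbra_mul_ketbra] at h
  have h2 := (Complex.le_def.mp h).1
  simp at h2
  linarith

/-- An involution with expectation one in the state `φ` fixes `φ`. -/
theorem mul_ketbra_of_trace_eq_one {φ : Ket n} (hφ : ‖φ‖ = 1) {T : Op n} (hT : T.IsHermitian)
    (hTT : T * T = 1) (h1 : (ketbra φ * T).trace = 1) : T * ketbra φ = ketbra φ := by
  have h2 : (T * ketbra φ).trace = 1 := by rw [Matrix.trace_mul_comm, h1]
  have h0 : (T * ketbra φ - ketbra φ)ᴴ * (T * ketbra φ - ketbra φ) = 0 := by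
    have e := ketbra_mul_mul_ketbra φ T
    rw [h1, one_smul] at e
    rw [Matrix.conjTranspose_sub, Matrix.conjTranspose_mul, ketbra_conjTranspose, hT.eq, sub_mul,
      mul_sub, mul_sub, mul_assoc, ← mul_assoc T T, hTT, one_mul, ketbra_mul_self hφ, e,
      ← mul_assoc, e]
    abel
  exact sub_eq_zero.mp (Matrix.conjTranspose_mul_self_eq_zero.mp h0)

theorem half_one_add_idempotent {T : Op n} (hTT : T * T = 1) :
    ((1 / 2 : ℂ) • (1 + T)) * ((1 / 2 : ℂ) • (1 + T)) = (1 / 2 : ℂ) • (1 + T) := by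
  rw [smul_mul_smul_comm, add_mul, mul_add, mul_add, hTT, one_mul, mul_one, one_mul]
  module

theorem half_one_add_isHermitian {T : Op n} (hT : T.IsHermitian) :
    ((1 / 2 : ℂ) • (1 + T)).IsHermitian := by
  rw [Matrix.IsHermitian, Matrix.conjTranspose_smul, Matrix.conjTranspose_add, hT.eq]
  simp

theorem overlap_le_sum_covariance {ψ φ : Ket n} (hψ : ‖ψ‖ = 1) (hφ : φ ∈ pureGaussian n)
    (a : Fin (2 * n)) :
    2 * overlap ψ φ - 1 ≤ ∑ b, covariance (ketbra φ) a b * covariance (ketbra ψ) a b := by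
  -- Row `a` is a unit vector orthogonal to the basis vector `u`, and it makes the expectation of
  -- `bilin u v` in `φ` equal to one.
  set v : Fin (2 * n) → ℝ := covariance (ketbra φ) a with hv
  set u : Fin (2 * n) → ℝ := Pi.single a 1 with hu
  have huv : u ⬝ᵥ v = 0 := by rw [hu, single_dotProduct, hv, covariance_self, mul_zero]
  have huu : u ⬝ᵥ u = 1 := by simp [hu]
  have hvv : v ⬝ᵥ v = 1 := by
    simpa [dotProduct, ← pow_two] using sum_covariance_sq_of_mem_pureGaussian hφ a
  have hval : ∀ χ : Ket n, u ⬝ᵥ covariance (ketbra χ) *ᵥ v =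
      ∑ b, covariance (ketbra φ) a b * covariance (ketbra χ) a b := fun χ => by
    rw [hu, single_dotProduct, one_mul, Matrix.mulVec, dotProduct]
    exact Finset.sum_congr rfl fun b _ => mul_comm _ _
  have hT : (bilin u v).IsHermitian := bilin_conjTranspose huv
  have hTT := bilin_sq huv huu hvv
  have h1 : (ketbra φ * bilin u v).trace = 1 := by
    rw [trace_ketbra_mul_bilin hφ.1 huv, hval]
    simp only [← pow_two]
    rw [sum_covariance_sq_of_mem_pureGaussian hφ a, Complex.ofReal_one]
  have hfix := mul_ketbra_of_trace_eq_one hφ.1 hT hTT h1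
  have hle := overlap_le_of_fixes (ψ := ψ) hφ.1 (half_one_add_isHermitian hT)
    (half_one_add_idempotent hTT) (by
      rw [Matrix.smul_mul, add_mul, one_mul, hfix]
      module)
  rw [Matrix.mul_smul, mul_add, mul_one, Matrix.trace_smul, Matrix.trace_add, trace_ketbra hψ,
    trace_ketbra_mul_bilin hψ huv, hval] at hle
  simp at hle
  linarith

theorem FAF_le_of_mem_pureGaussian {ψ φ : Ket n} (hψ : ‖ψ‖ = 1) (hφ : φ ∈ pureGaussian n) :
    FAF 1 (ketbra ψ) ≤ 4 * n * (1 - overlap ψ φ) := by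
  have hle := overlap_le_one hψ hφ.1
  have hrow : ∀ a : Fin (2 * n),
      1 - 4 * (1 - overlap ψ φ) ≤ ∑ b, covariance (ketbra ψ) a b ^ 2 := by
    intro a
    have h1 := overlap_le_sum_covariance hψ hφ a
    have hcs := Finset.sum_mul_sq_le_sq_mul_sq Finset.univ (covariance (ketbra φ) a)
      (covariance (ketbra ψ) a)
    rw [sum_covariance_sq_of_mem_pureGaussian hφ a, one_mul] at hcs
    refine le_trans ?_ hcs
    -- Squaring `2F - 1 ≤ S` needs `2F - 1 ≥ 0`; in the other case the lower bound to be proved is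
    -- negative.
    rcases le_total (overlap ψ φ) (1 / 2) with h | h
    · nlinarith [sq_nonneg (∑ b, covariance (ketbra φ) a b * covariance (ketbra ψ) a b)]
    · nlinarith
  have hs := Finset.sum_le_sum fun a (_ : a ∈ Finset.univ) => hrow a
  rw [Finset.sum_const, Finset.card_univ, Fintype.card_fin, nsmul_eq_mul] at hs
  push_cast at hs
  rw [FAF_one]
  linarith

/-! ### Normal form of skew-symmetric operators -/

section Skew

open Module Submodule
open scoped InnerProductSpace

/-- The square of `T` is symmetric. An eigenvector `b` of it with `T b ≠ 0` spans an invariant plane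
together with `T b`; if there is none in an eigenbasis, then `T = 0` and any orthonormal pair works
with `l = 0`. -/
theorem exists_skew_plane {E : Type*} [NormedAddCommGroup E] [InnerProductSpace ℝ E]
    [FiniteDimensional ℝ E] (hE : 2 ≤ finrank ℝ E) (T : E →ₗ[ℝ] E)
    (hT : ∀ x y, ⟪T x, y⟫_ℝ = -⟪x, T y⟫_ℝ) :
    ∃ (e f : E) (l : ℝ), ‖e‖ = 1 ∧ ‖f‖ = 1 ∧ ⟪e, f⟫_ℝ = 0 ∧ 0 ≤ l ∧ T f = l • e ∧ T e = -l • f := by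
  have hS : (T ∘ₗ T).IsSymmetric := fun x y => by
    rw [LinearMap.comp_apply, LinearMap.comp_apply, hT, hT, neg_neg]
  let b := hS.eigenvectorBasis rfl
  by_cases h0 : ∃ i, T (b i) ≠ 0
  · obtain ⟨i, hi⟩ := h0
    have hl : ‖T (b i)‖ ≠ 0 := norm_ne_zero_iff.mpr hi
    have hb : ‖b i‖ = 1 := b.orthonormal.1 i
    have hTT : T (T (b i)) = hS.eigenvalues rfl i • b i := hS.apply_eigenvectorBasis rfl i
    have hμ : hS.eigenvalues rfl i = -‖T (b i)‖ ^ 2 := by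
      have h1 := hT (b i) (T (b i))
      rw [hTT, inner_smul_right, real_inner_self_eq_norm_sq, real_inner_self_eq_norm_sq, hb] at h1
      linarith
    refine ⟨‖T (b i)‖⁻¹ • T (b i), b i, ‖T (b i)‖, ?_, hb, ?_, norm_nonneg _, ?_, ?_⟩
    · rw [norm_smul, norm_inv, norm_norm, inv_mul_cancel₀ hl]
    · have h1 := hT (b i) (b i)
      rw [real_inner_comm (T (b i)) (b i)] at h1
      rw [inner_smul_left, self_eq_neg.mp h1, mul_zero]
    · rw [smul_smul, mul_inv_cancel₀ hl, one_smul]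
    · rw [map_smul, hTT, hμ, smul_smul]
      congr 1
      field_simp
  · push Not at h0
    have hT0 : T = 0 := b.toBasis.ext fun i => by simpa using h0 i
    have b' := stdOrthonormalBasis ℝ E
    refine ⟨b' ⟨0, by omega⟩, b' ⟨1, by omega⟩, 0, b'.orthonormal.1 _, b'.orthonormal.1 _,
      b'.orthonormal.2 (by simp), le_rfl, by simp [hT0], by simp [hT0]⟩

theorem exists_skew_normal_form {E : Type*} [NormedAddCommGroup E] [InnerProductSpace ℝ E]
    [FiniteDimensional ℝ E] (m : ℕ) (hE : finrank ℝ E = 2 * m) (T : E →ₗ[ℝ] E)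
    (hT : ∀ x y, ⟪T x, y⟫_ℝ = -⟪x, T y⟫_ℝ) :
    ∃ (e f : Fin m → E) (l : Fin m → ℝ), Orthonormal ℝ e ∧ Orthonormal ℝ f ∧
      (∀ i j, ⟪e i, f j⟫_ℝ = 0) ∧ (∀ k, 0 ≤ l k) ∧ (∀ k, T (f k) = l k • e k) ∧
      ∀ k, T (e k) = -l k • f k := by
  induction m generalizing E with
  | zero =>
    refine ⟨Fin.elim0, Fin.elim0, Fin.elim0, ?_, ?_, ?_, ?_, ?_, ?_⟩
    · exact ⟨fun i => i.elim0, fun i => i.elim0⟩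
    · exact ⟨fun i => i.elim0, fun i => i.elim0⟩
    all_goals exact fun i => i.elim0
  | succ m ih =>
    obtain ⟨e, f, l, he, hf, hef, hl, hTf, hTe⟩ := exists_skew_plane (by omega) T hT
    have hon : Orthonormal ℝ ![e, f] := by
      rw [orthonormal_vecCons_iff]
      refine ⟨he, fun i => ?_, ?_⟩
      · fin_cases i; exact hef
      · rw [orthonormal_vecCons_iff]
        exact ⟨hf, fun i => i.elim0, fun i => i.elim0, fun i => i.elim0⟩
    let V : Submodule ℝ E := span ℝ (Set.range ![e, f])
    have hVe : e ∈ V := subset_span ⟨0, rfl⟩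
    have hVf : f ∈ V := subset_span ⟨1, rfl⟩
    have hV : ∀ x, x ∈ Vᗮ ↔ ⟪e, x⟫_ℝ = 0 ∧ ⟪f, x⟫_ℝ = 0 := by
      intro x
      refine ⟨fun hx => ⟨hx e hVe, hx f hVf⟩, fun hx => ?_⟩
      rw [mem_orthogonal]
      intro u hu
      induction hu using span_induction with
      | mem u hu =>
        obtain ⟨i, rfl⟩ := hu
        fin_cases i
        exacts [hx.1, hx.2]
      | zero => exact inner_zero_left _
      | add u v _ _ hu hv => rw [inner_add_left, hu, hv, add_zero]
      | smul c u _ hu => rw [inner_smul_left, hu, mul_zero]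
    -- Skew-symmetry carries invariance of the plane over to its complement, where the induction
    -- hypothesis applies.
    have hTV : ∀ x ∈ Vᗮ, T x ∈ Vᗮ := by
      intro x hx
      rw [hV] at hx ⊢
      have h1 := hT e x
      have h2 := hT f x
      rw [hTe, inner_smul_left, hx.2, mul_zero] at h1
      rw [hTf, inner_smul_left, hx.1, mul_zero] at h2
      exact ⟨by linarith, by linarith⟩
    have hdim : finrank ℝ Vᗮ = 2 * m := by
      have h1 := V.finrank_add_finrank_orthogonal
      have h2 : finrank ℝ V = Fintype.card (Fin 2) := finrank_span_eq_card hon.linearIndependent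
      rw [Fintype.card_fin] at h2
      omega
    obtain ⟨e', f', l', he', hf', hef', hl', hTf', hTe'⟩ :=
      ih hdim (T.restrict hTV) fun x y => hT x y
    refine ⟨Matrix.vecCons e fun i => (e' i : E), Matrix.vecCons f fun i => (f' i : E),
      Matrix.vecCons l l', ?_, ?_, ?_, ?_, ?_, ?_⟩
    · rw [orthonormal_vecCons_iff]
      exact ⟨he, fun i => ((hV _).mp (e' i).2).1, he'.comp_linearIsometry Vᗮ.subtypeₗᵢ⟩
    · rw [orthonormal_vecCons_iff]
      exact ⟨hf, fun i => ((hV _).mp (f' i).2).2, hf'.comp_linearIsometry Vᗮ.subtypeₗᵢ⟩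
    · refine Fin.cases (Fin.cases hef fun j => ?_) fun i => Fin.cases ?_ fun j => ?_
      · exact ((hV _).mp (f' j).2).1
      · exact (real_inner_comm _ _).trans ((hV _).mp (e' i).2).2
      · exact hef' i j
    · exact Fin.cases hl hl'
    · exact Fin.cases hTf fun k => congrArg Subtype.val (hTf' k)
    · exact Fin.cases hTe fun k => congrArg Subtype.val (hTe' k)

theorem trace_mul_self_of_skew_normal_form {E : Type*} [NormedAddCommGroup E]
    [InnerProductSpace ℝ E] [FiniteDimensional ℝ E] {m : ℕ} (hE : finrank ℝ E = 2 * m)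
    {T : E →ₗ[ℝ] E} {e f : Fin m → E} {l : Fin m → ℝ} (he : Orthonormal ℝ e)
    (hf : Orthonormal ℝ f) (hef : ∀ i j, ⟪e i, f j⟫_ℝ = 0) (hTf : ∀ k, T (f k) = l k • e k)
    (hTe : ∀ k, T (e k) = -l k • f k) :
    LinearMap.trace ℝ E (T ∘ₗ T) = -(2 * ∑ k, l k ^ 2) := by
  have hon : Orthonormal ℝ (Sum.elim e f) := by
    refine ⟨?_, ?_⟩
    · rintro (i | i)
      exacts [he.1 i, hf.1 i]
    · rintro (i | i) (j | j) hij
      · exact he.2 fun h => hij (congrArg _ h)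
      · exact hef i j
      · exact (real_inner_comm _ _).trans (hef j i)
      · exact hf.2 fun h => hij (congrArg _ h)
  have hcard : Fintype.card (Fin m ⊕ Fin m) = finrank ℝ E := by
    rw [hE, Fintype.card_sum, Fintype.card_fin, two_mul]
  let b : OrthonormalBasis (Fin m ⊕ Fin m) ℝ E :=
    OrthonormalBasis.mk hon (hon.linearIndependent.span_eq_top_of_card_eq_finrank' hcard).ge
  rw [LinearMap.trace_eq_sum_inner _ b, Fintype.sum_sum_type]
  have h1 : ∀ k, ⟪b (Sum.inl k), (T ∘ₗ T) (b (Sum.inl k))⟫_ℝ = -l k ^ 2 := fun k => by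
    simp [b, hTe, hTf, inner_smul_right, he.1 k, pow_two]
  have h2 : ∀ k, ⟪b (Sum.inr k), (T ∘ₗ T) (b (Sum.inr k))⟫_ℝ = -l k ^ 2 := fun k => by
    simp [b, hTe, hTf, inner_smul_right, hf.1 k, pow_two]
  simp only [h1, h2, Finset.sum_neg_distrib]
  ring

/-- The normal form of a real antisymmetric matrix. -/
theorem exists_antisymmetric_normal_form (G : Matrix (Fin (2 * n)) (Fin (2 * n)) ℝ)
    (hG : Gᵀ = -G) :
    ∃ (e f : Fin n → Fin (2 * n) → ℝ) (l : Fin n → ℝ),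
      (∀ i j, e i ⬝ᵥ e j = if i = j then 1 else 0) ∧
      (∀ i j, f i ⬝ᵥ f j = if i = j then 1 else 0) ∧ (∀ i j, e i ⬝ᵥ f j = 0) ∧
      (∀ k, 0 ≤ l k) ∧ (∀ k, e k ⬝ᵥ G *ᵥ f k = l k) ∧ (-(G ^ 2)).trace = 2 * ∑ k, l k ^ 2 := by
  let T : EuclideanSpace ℝ (Fin (2 * n)) →ₗ[ℝ] EuclideanSpace ℝ (Fin (2 * n)) :=
    Matrix.toLpLin 2 2 G
  have hinner : ∀ x y : EuclideanSpace ℝ (Fin (2 * n)), ⟪x, y⟫_ℝ = x.ofLp ⬝ᵥ y.ofLp := fun x y => by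
    rw [EuclideanSpace.inner_eq_star_dotProduct, dotProduct_comm]
    simp
  have hT : ∀ x y, ⟪T x, y⟫_ℝ = -⟪x, T y⟫_ℝ := fun x y => by
    rw [hinner, hinner]
    change (G *ᵥ x.ofLp) ⬝ᵥ y.ofLp = -(x.ofLp ⬝ᵥ G *ᵥ y.ofLp)
    rw [Matrix.dotProduct_mulVec, ← Matrix.mulVec_transpose, hG, Matrix.neg_mulVec,
      neg_dotProduct, neg_neg]
  have hE : finrank ℝ (EuclideanSpace ℝ (Fin (2 * n))) = 2 * n := by simp
  obtain ⟨e, f, l, he, hf, hef, hl, hTf, hTe⟩ := exists_skew_normal_form n hE T hT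
  refine ⟨fun k => (e k).ofLp, fun k => (f k).ofLp, l, fun i j => ?_, fun i j => ?_, fun i j => ?_,
    hl, fun k => ?_, ?_⟩
  · rw [← hinner, orthonormal_iff_ite.mp he]
  · rw [← hinner, orthonormal_iff_ite.mp hf]
  · rw [← hinner, hef]
  · have h1 : G *ᵥ (f k).ofLp = l k • (e k).ofLp := congrArg WithLp.ofLp (hTf k)
    rw [h1, dotProduct_smul, ← hinner, real_inner_self_eq_norm_sq, he.1 k]
    simp
  · have h1 := trace_mul_self_of_skew_normal_form hE he hf hef hTf hTe
    have h2 : LinearMap.trace ℝ _ (T ∘ₗ T) = (G * G).trace := by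
      rw [← Matrix.toLpLin_mul_same, Matrix.toLpLin_eq_toLin, Matrix.trace_toLin_eq]
    rw [Matrix.trace_neg, pow_two, ← h2, h1, neg_neg]

end Skew

/-! ### Gaussian states with given normal modes -/

-- The spectral projectors `(1 ± S)/2` define a continuous ring homomorphism from `ℂ × ℂ`, which
-- transports the scalar exponentials. Factoring out `2 cosh c` leaves a mode factor with `t = tanh
-- c`.
open scoped Matrix.Norms.Operator in
theorem exp_smul_of_mul_self_eq_one {S : Op n} (hS : S * S = 1) (c : ℝ) :
    NormedSpace.exp ((c : ℂ) • S) =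
      ((2 * Real.cosh c : ℝ) : ℂ) • ((1 / 2 : ℂ) • (1 + (Real.tanh c : ℂ) • S)) := by
  let φ : ℂ × ℂ →+* Op n :=
    { toFun := fun z => z.1 • ((1 / 2 : ℂ) • (1 + S)) + z.2 • ((1 / 2 : ℂ) • (1 - S))
      map_one' := by
        rw [Prod.fst_one, Prod.snd_one]
        module
      map_zero' := by simp
      map_add' := fun z w => by
        rw [Prod.fst_add, Prod.snd_add]
        module
      map_mul' := fun z w => by
        have h1 : (1 + S) * (1 + S) = (2 : ℂ) • (1 + S) := by
          rw [add_mul, mul_add, mul_add, hS]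
          simp only [one_mul, mul_one]
          module
        have h2 : (1 - S) * (1 - S) = (2 : ℂ) • (1 - S) := by
          rw [sub_mul, mul_sub, mul_sub, hS]
          simp only [one_mul, mul_one]
          module
        have h3 : (1 + S) * (1 - S) = 0 := by
          rw [add_mul, mul_sub, mul_sub, hS]
          simp only [one_mul, mul_one]
          abel
        have h4 : (1 - S) * (1 + S) = 0 := by
          rw [sub_mul, mul_add, mul_add, hS]
          simp only [one_mul, mul_one]
          abel
        rw [Prod.fst_mul, Prod.snd_mul]
        simp only [add_mul, mul_add _ (_ • _), smul_mul_smul_comm, h1, h2, h3, h4]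
        module }
  have hφ : Continuous φ := by
    change Continuous fun z : ℂ × ℂ =>
      z.1 • ((1 / 2 : ℂ) • (1 + S)) + z.2 • ((1 / 2 : ℂ) • (1 - S))
    fun_prop
  have h := NormedSpace.map_exp φ hφ ((c : ℂ), -(c : ℂ))
  have hl : φ ((c : ℂ), -(c : ℂ)) = (c : ℂ) • S := by
    change (c : ℂ) • ((1 / 2 : ℂ) • (1 + S)) + (-(c : ℂ)) • ((1 / 2 : ℂ) • (1 - S)) = _
    module
  have hr : φ (NormedSpace.exp ((c : ℂ), -(c : ℂ))) =
      Complex.exp c • ((1 / 2 : ℂ) • (1 + S)) + Complex.exp (-c) • ((1 / 2 : ℂ) • (1 - S)) := by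
    change (NormedSpace.exp ((c : ℂ), -(c : ℂ))).1 • ((1 / 2 : ℂ) • (1 + S)) +
      (NormedSpace.exp ((c : ℂ), -(c : ℂ))).2 • ((1 / 2 : ℂ) • (1 - S)) = _
    rw [Prod.fst_exp, Prod.snd_exp, Complex.exp_eq_exp_ℂ]
  rw [hl, hr] at h
  refine h.symm.trans ?_
  have hc : (Real.cosh c : ℂ) ≠ 0 := by exact_mod_cast (Real.cosh_pos c).ne'
  have e1 : ((2 : ℝ) : ℂ) * Real.cosh c * (1 / 2) * (Real.sinh c / Real.cosh c) = Real.sinh c := by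
    field_simp
    push_cast
    ring
  have e2 : ((2 : ℝ) : ℂ) * Real.cosh c * (1 / 2) = Real.cosh c := by
    push_cast
    ring
  have hrhs : ((2 * Real.cosh c : ℝ) : ℂ) • ((1 / 2 : ℂ) • (1 + (Real.tanh c : ℂ) • S)) =
      (Real.cosh c : ℂ) • (1 : Op n) + (Real.sinh c : ℂ) • S := by
    rw [Real.tanh_eq_sinh_div_cosh, Complex.ofReal_mul, Complex.ofReal_div, smul_smul, smul_add,
      smul_smul, e1, e2]
  rw [hrhs, Complex.ofReal_cosh, Complex.ofReal_sinh, Complex.cosh, Complex.sinh]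
  module

/-- The product of the operators `(1 + t S_k) / 2` over a list of modes. -/
noncomputable def modeProd {ι : Type*} (S : ι → Op n) (t : ℝ) (l : List ι) : Op n :=
  (l.map fun k => (1 / 2 : ℂ) • (1 + (t : ℂ) • S k)).prod

theorem modeProd_nil {ι : Type*} (S : ι → Op n) (t : ℝ) : modeProd S t [] = 1 := rfl

theorem modeProd_cons {ι : Type*} (S : ι → Op n) (t : ℝ) (k : ι) (l : List ι) :
    modeProd S t (k :: l) = (1 / 2 : ℂ) • (1 + (t : ℂ) • S k) * modeProd S t l := by
  rw [modeProd, List.map_cons, List.prod_cons, modeProd]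

theorem continuous_modeProd {ι : Type*} (S : ι → Op n) (l : List ι) :
    Continuous fun t : ℝ => modeProd S t l := by
  induction l with
  | nil => exact continuous_const
  | cons k l ih =>
    simp only [modeProd_cons]
    have h : Continuous fun t : ℝ => (1 / 2 : ℂ) • (1 + (t : ℂ) • S k) := by fun_prop
    exact h.mul ih

theorem commute_modeProd {ι : Type*} {S : ι → Op n} {c : Op n} {l : List ι}
    (h : ∀ k ∈ l, Commute c (S k)) (t : ℝ) : Commute c (modeProd S t l) := by
  refine Commute.list_prod_right _ _ fun x hx => ?_
  obtain ⟨k, hk, rfl⟩ := List.mem_map.mp hx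
  exact (((Commute.one_right c).add_right ((h k hk).smul_right _))).smul_right _

/-- Conjugation by `c` preserves the trace but flips the sign of `S * M`. -/
theorem trace_mul_eq_zero_of_anticommute {S M c : Op n} (hc : c * c = 1) (hS : c * S = -(S * c))
    (hM : Commute c M) : (S * M).trace = 0 := by
  have h : (S * M).trace = -(S * M).trace := by
    calc (S * M).trace = (c * (c * (S * M))).trace := by rw [← mul_assoc, hc, one_mul]
      _ = (c * (S * M) * c).trace := Matrix.trace_mul_comm _ _
      _ = -(S * M).trace := by
        rw [← mul_assoc, hS, neg_mul, neg_mul, mul_assoc S, hM.eq, ← mul_assoc S, mul_assoc (S * M),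
          hc, mul_one, Matrix.trace_neg]
  exact self_eq_neg.mp h

/-- A family of commuting Hermitian involutions, each of which anticommutes with an involution that
commutes with all the others. -/
structure IsModeFamily {ι : Type*} (S : ι → Op n) : Prop where
  isHermitian : ∀ k, (S k).IsHermitian
  mul_self : ∀ k, S k * S k = 1
  commute : ∀ k l, k ≠ l → Commute (S k) (S l)
  exists_flip : ∀ k, ∃ c : Op n, c * c = 1 ∧ c * S k = -(S k * c) ∧ ∀ l, k ≠ l → Commute c (S l)

namespace IsModeFamily

variable {ι : Type*} {S : ι → Op n}

/-- The flip of mode `k` kills the term containing `S k`, so each mode halves the trace,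
independently of `t`. With all `n` modes the trace is one, which gives both the normalisation and
rank one at `t = 1`. -/
theorem trace_modeProd (hS : IsModeFamily S) (t : ℝ) {l : List ι} (hl : l.Nodup) :
    (modeProd S t l).trace = (1 / 2) ^ l.length * 2 ^ n := by
  induction l with
  | nil => simp [modeProd_nil, Matrix.trace_one]
  | cons k l ih =>
    obtain ⟨hk, hl⟩ := List.nodup_cons.mp hl
    obtain ⟨c, hc, hcS, hcc⟩ := hS.exists_flip k
    have h0 := trace_mul_eq_zero_of_anticommute hc hcS
      (commute_modeProd (t := t) (l := l) fun j hj => hcc j fun e => hk (e ▸ hj))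
    rw [modeProd_cons, Matrix.smul_mul, add_mul, one_mul, Matrix.smul_mul, Matrix.trace_smul,
      Matrix.trace_add, Matrix.trace_smul, h0, smul_zero, add_zero, ih hl, List.length_cons,
      smul_eq_mul, pow_succ]
    ring

theorem exp_sum (hS : IsModeFamily S) (c : ℝ) {l : List ι} (hl : l.Nodup) :
    NormedSpace.exp ((c : ℂ) • (l.map S).sum) =
      ((2 * Real.cosh c : ℝ) : ℂ) ^ l.length • modeProd S (Real.tanh c) l := by
  induction l with
  | nil => simp [modeProd_nil]
  | cons k l ih =>
    obtain ⟨hk, hl⟩ := List.nodup_cons.mp hl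
    have hcomm : Commute ((c : ℂ) • S k) ((c : ℂ) • (l.map S).sum) := by
      refine Commute.smul_right (Commute.smul_left (Commute.list_sum_right _ _ fun x hx => ?_) _) _
      obtain ⟨j, hj, rfl⟩ := List.mem_map.mp hx
      exact hS.commute k j fun e => hk (e ▸ hj)
    rw [List.map_cons, List.sum_cons, smul_add, Matrix.exp_add_of_commute _ _ hcomm, ih hl,
      exp_smul_of_mul_self_eq_one (hS.mul_self k), modeProd_cons, smul_mul_smul_comm,
      List.length_cons, pow_succ']

theorem modeProd_one_isHermitian_and_idempotent (hS : IsModeFamily S) {l : List ι} (hl : l.Nodup) :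
    (modeProd S 1 l).IsHermitian ∧ modeProd S 1 l * modeProd S 1 l = modeProd S 1 l := by
  induction l with
  | nil => exact ⟨Matrix.isHermitian_one, mul_one _⟩
  | cons k l ih =>
    obtain ⟨hk, hl⟩ := List.nodup_cons.mp hl
    obtain ⟨h1, h2⟩ := ih hl
    have hcomm : Commute ((1 / 2 : ℂ) • (1 + S k)) (modeProd S 1 l) :=
      (((Commute.one_left _).add_left
        (commute_modeProd (fun j hj => hS.commute k j fun e => hk (e ▸ hj)) 1))).smul_left _
    rw [modeProd_cons, Complex.ofReal_one, one_smul]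
    refine ⟨?_, ?_⟩
    · rw [Matrix.IsHermitian, Matrix.conjTranspose_mul, h1.eq,
        (half_one_add_isHermitian (hS.isHermitian k)).eq, hcomm.eq]
    · rw [hcomm.symm.mul_mul_mul_comm, half_one_add_idempotent (hS.mul_self k), h2]

end IsModeFamily

theorem re_trace_ketbra_mul_nonneg (ψ : Ket n) {p : Op n} (hp : p.IsHermitian) (hpp : p * p = p) :
    0 ≤ (ketbra ψ * p).trace.re := by
  have h := (Matrix.posSemidef_conjTranspose_mul_self p).dotProduct_mulVec_nonneg ψ.ofLp
  rw [hp.eq, hpp, ← trace_ketbra_mul] at h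
  exact (Complex.le_def.mp h).1

theorem one_sub_idempotent {p : Op n} (hpp : p * p = p) : (1 - p) * (1 - p) = 1 - p := by
  rw [sub_mul, mul_sub, mul_sub, hpp]
  simp

/-- The union bound for the commuting projectors `(1 + S_k) / 2`. -/
theorem IsModeFamily.one_sub_trace_modeProd_le {ι : Type*} {S : ι → Op n} (hS : IsModeFamily S)
    {ψ : Ket n} (hψ : ‖ψ‖ = 1) {l : List ι} (hl : l.Nodup) :
    1 - (ketbra ψ * modeProd S 1 l).trace.re ≤
      (l.map fun k => (1 - (ketbra ψ * S k).trace.re) / 2).sum := by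
  induction l with
  | nil => simp [modeProd_nil, trace_ketbra hψ]
  | cons k l ih =>
    obtain ⟨hk, hl⟩ := List.nodup_cons.mp hl
    obtain ⟨h1, h2⟩ := hS.modeProd_one_isHermitian_and_idempotent hl
    have hp := half_one_add_isHermitian (hS.isHermitian k)
    have hpp := half_one_add_idempotent (hS.mul_self k)
    have hcomm : Commute ((1 / 2 : ℂ) • (1 + S k)) (modeProd S 1 l) :=
      (((Commute.one_left _).add_left
        (commute_modeProd (fun j hj => hS.commute k j fun e => hk (e ▸ hj)) 1))).smul_left _
    have hval : (ketbra ψ * ((1 / 2 : ℂ) • (1 + S k))).trace.re =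
        (1 + (ketbra ψ * S k).trace.re) / 2 := by
      rw [Matrix.mul_smul, mul_add, mul_one, Matrix.trace_smul, Matrix.trace_add, trace_ketbra hψ]
      simp
      ring
    rw [modeProd_cons, Complex.ofReal_one, one_smul, List.map_cons, List.sum_cons]
    set p := (1 / 2 : ℂ) • (1 + S k)
    set q := modeProd S 1 l
    have hc : Commute (1 - p) (1 - q) :=
      (Commute.sub_left (Commute.one_left _) (Commute.sub_right (Commute.one_right _) hcomm))
    -- For commuting projectors, positivity of `(1 - p)(1 - q)` is the union bound `1 - pq ≤ (1 - p)
    -- + (1 - q)`.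
    have h := re_trace_ketbra_mul_nonneg ψ (p := (1 - p) * (1 - q))
      (by rw [Matrix.IsHermitian, Matrix.conjTranspose_mul, (Matrix.isHermitian_one.sub hp).eq,
            (Matrix.isHermitian_one.sub h1).eq, hc.eq])
      (by rw [hc.symm.mul_mul_mul_comm, one_sub_idempotent hpp, one_sub_idempotent h2])
    have e : (1 - p) * (1 - q) = 1 - p - q + p * q := by noncomm_ring
    rw [e, mul_add, mul_sub, mul_sub, mul_one, Matrix.trace_add, Matrix.trace_sub, Matrix.trace_sub,
      trace_ketbra hψ] at h
    simp only [Complex.add_re, Complex.sub_re, Complex.one_re, hval] at h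
    have := ih hl
    linarith

/-- A Hermitian idempotent of trace one is of rank one. -/
theorem exists_eq_ketbra {p : Op n} (hp : p.IsHermitian) (hpp : p * p = p) (ht : p.trace = 1) :
    ∃ φ : Ket n, ‖φ‖ = 1 ∧ p = ketbra φ := by
  have hne : ∃ y, p.col y ≠ 0 := by
    by_contra! h
    have : p = 0 := by
      ext x y
      exact congrFun (h y) x
    rw [this, Matrix.trace_zero] at ht
    exact zero_ne_one ht
  obtain ⟨y, hy⟩ := hne
  -- Idempotence makes `p` fix each of its columns.
  set v : Ket n := WithLp.toLp 2 (p.col y) with hv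
  have hv0 : ‖v‖ ≠ 0 := norm_ne_zero_iff.mpr fun h => hy (congrArg WithLp.ofLp h)
  have hpv : p *ᵥ v.ofLp = v.ofLp := by
    ext x
    exact congrFun (congrFun hpp x) y
  set φ : Ket n := ((‖v‖⁻¹ : ℝ) : ℂ) • v with hφ
  have hφ1 : ‖φ‖ = 1 := by
    rw [hφ, norm_smul, Complex.norm_real, norm_inv, norm_norm, inv_mul_cancel₀ hv0]
  have hpφ : p *ᵥ φ.ofLp = φ.ofLp := by
    rw [hφ, WithLp.ofLp_smul, Matrix.mulVec_smul, hpv]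
  have hfix : p * ketbra φ = ketbra φ := by
    rw [ketbra_eq_vecMulVec, Matrix.mul_vecMulVec, hpφ]
  have hfix' : ketbra φ * p = ketbra φ := by
    have := congrArg Matrix.conjTranspose hfix
    rwa [Matrix.conjTranspose_mul, ketbra_conjTranspose, hp.eq] at this
  -- The squared Hilbert–Schmidt norm of the difference is `1 - 1 - 1 + 1 = 0`.
  refine ⟨φ, hφ1, sub_eq_zero.mp (Matrix.trace_conjTranspose_mul_self_eq_zero_iff.mp ?_)⟩
  rw [Matrix.conjTranspose_sub, ketbra_conjTranspose, hp.eq, sub_mul, mul_sub, mul_sub, hpp, hfix,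
    hfix', ketbra_mul_self hφ1, Matrix.trace_sub, Matrix.trace_sub, Matrix.trace_sub, ht,
    trace_ketbra hφ1]
  ring

/-- Anticommutation folds the part below the diagonal onto the part above it, and orthogonality
removes the diagonal. This gives `bilin u v` the form of a Gaussian exponent. -/
theorem sum_lt_eq_lin_mul_lin {u v : Fin (2 * n) → ℝ} (h : u ⬝ᵥ v = 0) :
    ∑ a, ∑ b, (if a < b then ((u a * v b - v a * u b : ℝ) : ℂ) • (majorana a * majorana b)
      else 0 : Op n) = lin u * lin v := by
  have hd : ∑ a, ∑ b, (if a = b then ((u a : ℂ) * v b) • (majorana a * majorana b) else 0 : Op n)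
      = 0 := by
    simp only [Finset.sum_ite_eq, Finset.mem_univ, if_true, majorana_sq, ← Finset.sum_smul]
    have : ∑ a, (u a : ℂ) * v a = 0 := by
      rw [dotProduct] at h
      exact_mod_cast h
    rw [this, zero_smul]
  have hs : ∑ a, ∑ b, (if a < b then ((-(v a * u b) : ℝ) : ℂ) • (majorana a * majorana b)
      else 0 : Op n) =
      ∑ a, ∑ b, (if b < a then ((u a : ℂ) * v b) • (majorana a * majorana b) else 0 : Op n) := by
    rw [Finset.sum_comm]
    refine Finset.sum_congr rfl fun a _ => Finset.sum_congr rfl fun b _ => ?_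
    split_ifs with hab
    · rw [majorana_mul_of_lt hab]
      push_cast
      module
    · rfl
  have hsplit : ∑ a, ∑ b, (if a < b then ((u a * v b - v a * u b : ℝ) : ℂ) •
      (majorana a * majorana b) else 0 : Op n) =
      ∑ a, ∑ b, (if a < b then ((u a : ℂ) * v b) • (majorana a * majorana b) else 0 : Op n) +
      ∑ a, ∑ b, (if a < b then ((-(v a * u b) : ℝ) : ℂ) • (majorana a * majorana b)
        else 0 : Op n) := by
    simp only [← Finset.sum_add_distrib]
    refine Finset.sum_congr rfl fun a _ => Finset.sum_congr rfl fun b _ => ?_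
    split_ifs
    · push_cast
      module
    · rw [add_zero]
  rw [hsplit, hs, lin_mul_lin]
  refine (add_zero _).symm.trans ((congrArg (_ + ·) hd.symm).trans ?_)
  simp only [← Finset.sum_add_distrib]
  refine Finset.sum_congr rfl fun a _ => Finset.sum_congr rfl fun b _ => ?_
  rcases lt_trichotomy a b with hab | hab | hab
  · simp [hab, hab.ne, hab.not_gt]
  · simp [hab]
  · simp [hab, hab.ne', hab.not_gt]

theorem commute_lin_bilin {u v w : Fin (2 * n) → ℝ} (hu : w ⬝ᵥ u = 0) (hv : w ⬝ᵥ v = 0) :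
    Commute (lin w) (bilin u v) := by
  refine Commute.smul_right ?_ _
  rw [Commute, SemiconjBy, ← mul_assoc, lin_mul_lin_of_orthogonal hu, neg_mul, mul_assoc,
    lin_mul_lin_of_orthogonal hv, mul_neg, neg_neg, mul_assoc]

theorem isModeFamily_bilin {e f : Fin n → Fin (2 * n) → ℝ}
    (he : ∀ i j, e i ⬝ᵥ e j = if i = j then 1 else 0)
    (hf : ∀ i j, f i ⬝ᵥ f j = if i = j then 1 else 0) (hef : ∀ i j, e i ⬝ᵥ f j = 0) :
    IsModeFamily fun k => bilin (e k) (f k) where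
  isHermitian k := bilin_conjTranspose (hef k k)
  mul_self k := bilin_sq (hef k k) (by simp [he]) (by simp [hf])
  commute k l hkl := by
    refine Commute.smul_left (Commute.mul_left ?_ ?_) _
    · exact commute_lin_bilin (by simp [he, hkl]) (hef k l)
    · exact commute_lin_bilin (by rw [dotProduct_comm, hef]) (by simp [hf, hkl])
  exists_flip k := by
    -- The operator `e_k(γ)` anticommutes with `S_k`, one of whose factors it is, and passes two
    -- anticommuting factors in every other `S_l`.
    refine ⟨lin (e k), lin_sq (by simp [he]), ?_, fun l hkl =>
      commute_lin_bilin (by simp [he, hkl]) (hef k l)⟩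
    rw [bilin, Matrix.mul_smul, Matrix.smul_mul, mul_assoc, ← smul_neg]
    congr 1
    rw [lin_mul_lin_of_orthogonal ((dotProduct_comm _ _).trans (hef k k)), mul_neg, neg_neg]

theorem isGaussian_modeProd {e f : Fin n → Fin (2 * n) → ℝ}
    (he : ∀ i j, e i ⬝ᵥ e j = if i = j then 1 else 0)
    (hf : ∀ i j, f i ⬝ᵥ f j = if i = j then 1 else 0) (hef : ∀ i j, e i ⬝ᵥ f j = 0) :
    IsGaussian (modeProd (fun k => bilin (e k) (f k)) 1 (List.finRange n)) := by
  have hS := isModeFamily_bilin he hf hef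
  have hnd := List.nodup_finRange n
  have hmem : ∀ t ∈ Set.Ioo (-1 : ℝ) 1, modeProd (fun k => bilin (e k) (f k)) t (List.finRange n) ∈
      {σ : Op n | ∃ K : Matrix (Fin (2 * n)) (Fin (2 * n)) ℝ, Kᵀ = -K ∧ σ = gaussianState K} := by
    intro t ht
    set c := Real.artanh t with hc
    have hct : Real.tanh c = t := Real.tanh_artanh ht
    -- The factor `2c` cancels the one half in `-i/2`, so that the exponent is `c ∑ S_k` with `tanh
    -- c = t`.
    refine ⟨Matrix.of fun a b => 2 * c * ∑ k, (e k a * f k b - f k a * e k b), ?_, ?_⟩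
    · ext a b
      simp only [Matrix.transpose_apply, Matrix.of_apply, Matrix.neg_apply, ← mul_neg,
        ← Finset.sum_neg_distrib]
      congr 1
      exact Finset.sum_congr rfl fun k _ => by ring
    · have hexp : gaussianExp (Matrix.of fun a b => 2 * c * ∑ k, (e k a * f k b - f k a * e k b)) =
          ((2 * Real.cosh c : ℝ) : ℂ) ^ n •
            modeProd (fun k => bilin (e k) (f k)) t (List.finRange n) := by
        have h1 := hS.exp_sum c hnd
        rw [← Fin.sum_univ_def, hct, List.length_finRange] at h1
        rw [← h1, gaussianExp]
        congr 1
        have h2 : ∀ k, bilin (e k) (f k) = (-Complex.I) • ∑ a, ∑ b, (if a < b then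
            ((e k a * f k b - f k a * e k b : ℝ) : ℂ) • (majorana a * majorana b) else 0 : Op n) :=
          fun k => by rw [sum_lt_eq_lin_mul_lin (hef k k), bilin]
        have h3 : ∑ k, bilin (e k) (f k) = (-Complex.I) • ∑ a, ∑ b, (if a < b then
            ((∑ k, (e k a * f k b - f k a * e k b) : ℝ) : ℂ) • (majorana a * majorana b)
              else 0 : Op n) := by
          rw [Finset.sum_congr rfl fun k _ => h2 k, ← Finset.smul_sum]
          congr 1
          rw [Finset.sum_comm]
          refine Finset.sum_congr rfl fun a _ => ?_
          rw [Finset.sum_comm]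
          refine Finset.sum_congr rfl fun b _ => ?_
          split_ifs
          · rw [← Finset.sum_smul, Complex.ofReal_sum]
          · exact Finset.sum_const_zero
        rw [h3, smul_smul]
        simp only [Finset.smul_sum, smul_ite, smul_zero, Matrix.of_apply, smul_smul]
        refine Finset.sum_congr rfl fun a _ => Finset.sum_congr rfl fun b _ => ?_
        split_ifs
        · congr 1
          push_cast
          ring
        · rfl
      have htr : (modeProd (fun k => bilin (e k) (f k)) t (List.finRange n)).trace = 1 := by
        rw [hS.trace_modeProd t hnd, List.length_finRange, ← mul_pow]
        norm_num
      have hne : ((2 * Real.cosh c : ℝ) : ℂ) ^ n ≠ 0 :=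
        pow_ne_zero _ (by exact_mod_cast (mul_pos two_pos (Real.cosh_pos c)).ne')
      rw [gaussianState, hexp, Matrix.trace_smul, htr, smul_eq_mul, mul_one, smul_smul,
        inv_mul_cancel₀ hne, one_smul]
  -- The value `t = 1` corresponds to infinite `c` and is reached only as a limit from below.
  have hlim : Filter.Tendsto (fun t : ℝ => modeProd (fun k => bilin (e k) (f k)) t (List.finRange n))
      (nhdsWithin 1 (Set.Iio 1)) (nhds (modeProd (fun k => bilin (e k) (f k)) 1 (List.finRange n))) :=
    ((continuous_modeProd _ _).tendsto 1).mono_left nhdsWithin_le_nhds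
  exact mem_closure_of_tendsto hlim
    (Filter.mem_of_superset (Ioo_mem_nhdsLT (by norm_num : (-1 : ℝ) < 1)) hmem)

/-- Every pure state has a pure Gaussian state at squared distance at most half the antiflatness. -/
theorem exists_pureGaussian_overlap {ψ : Ket n} (hψ : ‖ψ‖ = 1) :
    ∃ φ ∈ pureGaussian n, 1 - overlap ψ φ ≤ 1 / 2 * FAF 1 (ketbra ψ) := by
  obtain ⟨e, f, l, he, hf, hef, hl, hG, htr⟩ :=
    exists_antisymmetric_normal_form (covariance (ketbra ψ)) (covariance_transpose _)
  have hS := isModeFamily_bilin he hf hef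
  have hnd := List.nodup_finRange n
  obtain ⟨hp, hpp⟩ := hS.modeProd_one_isHermitian_and_idempotent hnd
  have ht : (modeProd (fun k => bilin (e k) (f k)) 1 (List.finRange n)).trace = 1 := by
    rw [hS.trace_modeProd 1 hnd, List.length_finRange, ← mul_pow]
    norm_num
  obtain ⟨φ, hφ, hpφ⟩ := exists_eq_ketbra hp hpp ht
  refine ⟨φ, ⟨hφ, hpφ ▸ isGaussian_modeProd he hf hef⟩, ?_⟩
  have hval : ∀ k, (ketbra ψ * bilin (e k) (f k)).trace.re = l k := fun k => by
    rw [trace_ketbra_mul_bilin hψ (hef k k), hG, Complex.ofReal_re]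
  have hl1 : ∀ k, l k ≤ 1 := fun k => by
    have h := re_trace_ketbra_mul_nonneg ψ
      (Matrix.isHermitian_one.sub (half_one_add_isHermitian (hS.isHermitian k)))
      (one_sub_idempotent (half_one_add_idempotent (hS.mul_self k)))
    rw [mul_sub, mul_one, Matrix.mul_smul, mul_add, mul_one, Matrix.trace_sub, Matrix.trace_smul,
      Matrix.trace_add, trace_ketbra hψ, Complex.sub_re] at h
    simp [hval] at h
    linarith
  have hle := hS.one_sub_trace_modeProd_le hψ hnd
  rw [hpφ, trace_ketbra_mul_ketbra, Complex.ofReal_re, ← Fin.sum_univ_def] at hle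
  simp only [hval] at hle
  refine hle.trans ?_
  -- Here `l_k² ≤ l_k`, since `0 ≤ l_k ≤ 1`.
  have hsum : ∑ k, (1 - l k) / 2 ≤ ∑ k, (1 / 2 - 1 / 2 * l k ^ 2) :=
    Finset.sum_le_sum fun k _ => by nlinarith [hl k, hl1 k]
  refine hsum.trans (le_of_eq ?_)
  rw [FAF, pow_one, htr, Finset.sum_sub_distrib, ← Finset.mul_sum]
  simp
  ring

/-! ### The minimum is attained -/

theorem continuous_ketbra : Continuous (ketbra : Ket n → Op n) := by
  refine continuous_matrix fun x y => ?_
  change Continuous fun ψ : Ket n => ψ x * star (ψ y)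
  fun_prop

theorem isCompact_pureGaussian : IsCompact (pureGaussian n) := by
  have h : pureGaussian n = Metric.sphere (0 : Ket n) 1 ∩ {φ | IsGaussian (ketbra φ)} := by
    ext φ
    simp [pureGaussian]
  rw [h]
  exact (isCompact_sphere _ _).inter_right (isClosed_closure.preimage continuous_ketbra)

theorem continuous_overlap (ψ : Ket n) : Continuous (overlap ψ) :=
  Complex.continuous_re.comp ((continuous_const.mul continuous_ketbra).matrix_trace)

theorem isLeast_epsG {ψ : Ket n} (hψ : ‖ψ‖ = 1) : IsLeast (gaussianDistances ψ) (epsG ψ) := by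
  have himg : gaussianDistances ψ = (fun φ => √(1 - overlap ψ φ)) '' pureGaussian n := by
    ext d
    constructor
    · rintro ⟨φ, hφ, rfl⟩
      exact ⟨φ, hφ, (traceDist_ketbra hψ hφ.1).symm⟩
    · rintro ⟨φ, hφ, rfl⟩
      exact ⟨φ, hφ, (traceDist_ketbra hψ hφ.1).symm⟩
  have hc : IsCompact (gaussianDistances ψ) := by
    rw [himg]
    exact isCompact_pureGaussian.image
      (Real.continuous_sqrt.comp (continuous_const.sub (continuous_overlap ψ)))
  obtain ⟨φ, hφ, -⟩ := exists_pureGaussian_overlap hψ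
  exact hc.isLeast_sInf ⟨_, φ, hφ, rfl⟩

end Fermion

/-! ### The two-sided bound -/

theorem mainTheorem3 (n : ℕ) (hn : 1 ≤ n) (ψ : Fermion.Ket n) (hψ : ‖ψ‖ = 1) :
    IsLeast (Fermion.gaussianDistances ψ) (Fermion.epsG ψ) ∧
    1 / (4 * (n : ℝ)) * Fermion.FAF 1 (Fermion.ketbra ψ) ≤ Fermion.epsG ψ ^ 2 ∧
    Fermion.epsG ψ ^ 2 ≤ 1 / 2 * Fermion.FAF 1 (Fermion.ketbra ψ) := by
  have hleast := Fermion.isLeast_epsG hψ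
  have hsq : ∀ φ ∈ Fermion.pureGaussian n,
      Fermion.traceDist (Fermion.ketbra ψ) (Fermion.ketbra φ) ^ 2 = 1 - Fermion.overlap ψ φ :=
    fun φ hφ => by
      rw [Fermion.traceDist_ketbra hψ hφ.1,
        Real.sq_sqrt (sub_nonneg.mpr (Fermion.overlap_le_one hψ hφ.1))]
  -- The lower bound holds for every pure Gaussian state, so it is applied to a minimiser; the upper
  -- bound compares the minimum with the state built from the normal form.
  obtain ⟨φ, hφ, hε⟩ := hleast.1
  have hε0 : 0 ≤ Fermion.epsG ψ := by
    rw [hε, Fermion.traceDist_ketbra hψ hφ.1]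
    exact Real.sqrt_nonneg _
  refine ⟨hleast, ?_, ?_⟩
  · have hn0 : (0 : ℝ) < 4 * n := by
      have : (0 : ℝ) < n := by exact_mod_cast hn
      linarith
    rw [hε, hsq φ hφ, one_div, inv_mul_le_iff₀ hn0]
    exact Fermion.FAF_le_of_mem_pureGaussian hψ hφ
  · obtain ⟨χ, hχ, hle⟩ := Fermion.exists_pureGaussian_overlap hψ
    refine le_trans ?_ hle
    rw [← hsq χ hχ]
    exact pow_le_pow_left₀ hε0 (hleast.2 ⟨χ, hχ, rfl⟩) 2
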